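/- **Proposition 7.2.** Let $k\ge 1$, $p=2k$ and $0<l<\infty$. Let $J_k$ be the $k\times k$ matrix whose entries on the antidiagonal, read from the upper right to the lower left corner, are $1,-1,\dots,(-1)^{k-1}$, and whose other entries are $0$. For a function $y$ on $[0,l]$ put $$Y_0(x)=\operatorname{col}\bigl(y(x),y'(x),\dots,y^{(k-1)}(x)\bigr),\qquad Y_1(x)=\operatorname{col}\bigl(y^{(k)}(x),y^{(k+1)}(x),\dots,y^{(2k-1)}(x)\bigr)\in\mathbb{C}^k .$$ Let $V,\widetilde V$ be arbitrary unitary operators in $\mathbb{C}^k$. Let $\mathfrak D$ be the set of all $y\in L^2(0,l)$ that are $p$ times differentiable in the $L^2$ sense (that is, $y\in W_2^p(0,l)$: $y\in C^{p-1}[0,l]$, $y^{(p-1)}$ is absolutely continuous on $[0,l]$, and $y^{(p)}\in L^2(0,l)$) and satisfy the boundary conditions $$2Y_0(l)=(V+\widetilde V)Y_0(0)+i(V-\widetilde V)J_kY_1(0),$$ $$2iJ_kY_1(l)=(V-\widetilde V)Y_0(0)+i(V+\widetilde V)J_kY_1(0).$$ Then the operator $(-iD)^p$, $D=\frac{d}{dx}$,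 with domain $\mathfrak D$ is a densely defined self-adjoint operator in $L^2(0,l)$. -/

import Mathlib

noncomputable section

namespace UnseparatedBVP

open MeasureTheory Set Filter

/-- The Euclidean space `E^(k)` of complex columns of height `k`. -/
abbrev E (k : ℕ) : Type := EuclideanSpace ℂ (Fin k)

/-- Lebesgue measure on the open interval `(0, l)`. -/
abbrev μ (l : ℝ) : Measure ℝ := volume.restrict (Ioo 0 l)

/-- The Hilbert space `L²(0, l)` of complex-valued functions. -/
abbrev H (l : ℝ) : Type := Lp ℂ 2 (μ l)

/-- The `j`-th derivative of `y` on the closed interval `[0, l]` (one-sided at the end points). -/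
abbrev der (l : ℝ) (j : ℕ) (y : ℝ → ℂ) : ℝ → ℂ := iteratedDerivWithin j y (Icc 0 l)

/-- The `n × n` matrix whose entries are `1, -1, 1, …, (-1)^(n-1)` along the antidiagonal
(from the upper right to the lower left corner) and `0` elsewhere. -/
def J (n : ℕ) : Matrix (Fin n) (Fin n) ℂ :=
  Matrix.of fun a b => if (a : ℕ) + (b : ℕ) + 1 = n then (-1) ^ (a : ℕ) else 0

/-- `Y₀(x) = col (y(x), y'(x), …, y^(k-1)(x))`. -/
def Y₀ (k : ℕ) (l : ℝ) (y : ℝ → ℂ) (x : ℝ) : E k :=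
  WithLp.toLp 2 fun j : Fin k => der l (j : ℕ) y x

/-- `Y₁(x) = col (y^(k)(x), y^(k+1)(x), …, y^(2k-1)(x))`. -/
def Y₁ (k : ℕ) (l : ℝ) (y : ℝ → ℂ) (x : ℝ) : E k :=
  WithLp.toLp 2 fun j : Fin k => der l (k + (j : ℕ)) y x

/-- The vector `J_k Y₁(x)`. -/
def JY₁ (k : ℕ) (l : ℝ) (y : ℝ → ℂ) (x : ℝ) : E k :=
  Matrix.toEuclideanLin (J k) (Y₁ k l y x)

/-- `y` is `p ≥ 1` times differentiable on `[0, l]` in the `L²` sense: `y` has `p - 1` continuous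
derivatives on `[0, l]`, the derivative `y^(p-1)` is absolutely continuous on `[0, l]`, and
`y^(p)`, which therefore exists almost everywhere, lies in `L²(0, l)`.
These `y` are the continuous representatives of the Sobolev space `W_2^p(0, l)`. -/
structure IsSobolev (p : ℕ) (l : ℝ) (y : ℝ → ℂ) : Prop where
  contDiffOn : ContDiffOn ℝ ((p - 1 : ℕ) : WithTop ℕ∞) y (Icc 0 l)
  absCont : AbsolutelyContinuousOnInterval (der l (p - 1) y) 0 l
  memLp : MemLp (der l p y) 2 (μ l)

/-- The unseparated boundary conditions given by operators `V`, `W` in `E^(k)`. -/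
structure BoundaryConditions (k : ℕ) (l : ℝ) (V W : E k →L[ℂ] E k) (y : ℝ → ℂ) : Prop where
  fst : (2 : ℂ) • Y₀ k l y l = (V + W) (Y₀ k l y 0) + Complex.I • (V - W) (JY₁ k l y 0)
  snd : (2 * Complex.I : ℂ) • JY₁ k l y l
    = (V - W) (Y₀ k l y 0) + Complex.I • (V + W) (JY₁ k l y 0)

/-! ### Helper facts: linearity and independence of representatives -/

lemma IsSobolev.contDiffWithinAt {p : ℕ} {l : ℝ} {y : ℝ → ℂ} (h : IsSobolev p l y) {j : ℕ}
    (hj : j < p) {x : ℝ} (hx : x ∈ Icc 0 l) : ContDiffWithinAt ℝ j y (Icc 0 l) x :=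
  (h.contDiffOn x hx).of_le (by exact_mod_cast Nat.le_sub_one_of_lt hj)

lemma der_add {p : ℕ} {l : ℝ} (hl : 0 < l) {y z : ℝ → ℂ} (hy : IsSobolev p l y)
    (hz : IsSobolev p l z) {j : ℕ} (hj : j < p) {x : ℝ} (hx : x ∈ Icc 0 l) :
    der l j (y + z) x = der l j y x + der l j z x :=
  iteratedDerivWithin_add hx (uniqueDiffOn_Icc hl) (hy.contDiffWithinAt hj hx)
    (hz.contDiffWithinAt hj hx)

lemma der_smul {l : ℝ} (c : ℂ) (y : ℝ → ℂ) (j : ℕ) (x : ℝ) :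
    der l j (c • y) x = c * der l j y x := by
  simp

lemma absCont_congr {f g : ℝ → ℂ} {a b : ℝ}
    (hf : AbsolutelyContinuousOnInterval f a b) (h : EqOn f g (uIcc a b)) :
    AbsolutelyContinuousOnInterval g a b := by
  rw [absolutelyContinuousOnInterval_iff] at hf ⊢
  intro ε hε
  obtain ⟨δ, hδ, H⟩ := hf ε hε
  refine ⟨δ, hδ, fun P hP hs => ?_⟩
  have hfg : ∑ i ∈ Finset.range P.1, dist (g (P.2 i).1) (g (P.2 i).2)
      = ∑ i ∈ Finset.range P.1, dist (f (P.2 i).1) (f (P.2 i).2) :=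
    Finset.sum_congr rfl fun i hi => by rw [h (hP.1 i hi).1, h (hP.1 i hi).2]
  rw [hfg]
  exact H P hP hs

/-- The highest derivative exists almost everywhere. -/
lemma IsSobolev.ae_differentiable {p : ℕ} {l : ℝ} (hl : 0 < l) {y : ℝ → ℂ}
    (hy : IsSobolev p l y) :
    ∀ᵐ x ∂(μ l), DifferentiableWithinAt ℝ (der l (p - 1) y) (Icc 0 l) x := by
  rw [ae_restrict_iff' measurableSet_Ioo]
  filter_upwards [hy.absCont.boundedVariationOn.ae_differentiableAt_of_mem_uIcc] with x hx hx'
  exact (hx (by rw [uIcc_of_le hl.le]; exact Ioo_subset_Icc_self hx')).differentiableWithinAt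

lemma der_add_ae {p : ℕ} (hp : 0 < p) {l : ℝ} (hl : 0 < l) {y z : ℝ → ℂ}
    (hy : IsSobolev p l y) (hz : IsSobolev p l z) :
    der l p (y + z) =ᵐ[μ l] der l p y + der l p z := by
  obtain ⟨q, rfl⟩ : ∃ q, p = q + 1 := ⟨p - 1, by omega⟩
  filter_upwards [hy.ae_differentiable hl, hz.ae_differentiable hl,
    ae_restrict_mem measurableSet_Ioo] with x h1 h2 hx
  have hx := Ioo_subset_Icc_self hx
  have hq : EqOn (der l q (y + z)) (der l q y + der l q z) (Icc 0 l) :=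
    fun t ht => der_add hl hy hz (Nat.lt_succ_self q) ht
  simp only [Pi.add_apply, der, iteratedDerivWithin_succ]
  rw [derivWithin_congr hq (hq hx)]
  exact derivWithin_add h1 h2

lemma IsSobolev.add {p : ℕ} (hp : 0 < p) {l : ℝ} (hl : 0 < l) {y z : ℝ → ℂ}
    (hy : IsSobolev p l y) (hz : IsSobolev p l z) : IsSobolev p l (y + z) where
  contDiffOn := hy.contDiffOn.add hz.contDiffOn
  absCont := absCont_congr (hy.absCont.add hz.absCont) fun x hx =>
    (der_add hl hy hz (by omega) (by rwa [uIcc_of_le hl.le] at hx)).symm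
  memLp := (memLp_congr_ae (der_add_ae hp hl hy hz)).2 (hy.memLp.add hz.memLp)

lemma IsSobolev.smul {p : ℕ} {l : ℝ} (c : ℂ) {y : ℝ → ℂ}
    (hy : IsSobolev p l y) : IsSobolev p l (c • y) where
  contDiffOn := hy.contDiffOn.const_smul c
  absCont := absCont_congr (hy.absCont.const_smul c) fun x _ => by simp
  memLp := by
    have : der l p (c • y) = c • der l p y := funext fun x => by simp
    rw [this]
    exact hy.memLp.const_smul c

lemma IsSobolev.zero {p : ℕ} {l : ℝ} : IsSobolev p l 0 := by
  have h (j : ℕ) : der l j (0 : ℝ → ℂ) = fun _ => 0 := by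
    funext x
    simp
  refine ⟨contDiffOn_const, ?_, ?_⟩
  · rw [h, absolutelyContinuousOnInterval_iff]
    exact fun ε hε => ⟨1, one_pos, fun _ _ _ => by simpa using hε⟩
  · rw [h]
    exact MemLp.zero

lemma Y₀_add {k : ℕ} {l : ℝ} (hl : 0 < l) {y z : ℝ → ℂ} (hy : IsSobolev (2 * k) l y)
    (hz : IsSobolev (2 * k) l z) {x : ℝ} (hx : x ∈ Icc 0 l) :
    Y₀ k l (y + z) x = Y₀ k l y x + Y₀ k l z x := by
  ext j
  exact der_add hl hy hz (by omega) hx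

lemma JY₁_add {k : ℕ} {l : ℝ} (hl : 0 < l) {y z : ℝ → ℂ} (hy : IsSobolev (2 * k) l y)
    (hz : IsSobolev (2 * k) l z) {x : ℝ} (hx : x ∈ Icc 0 l) :
    JY₁ k l (y + z) x = JY₁ k l y x + JY₁ k l z x := by
  have : Y₁ k l (y + z) x = Y₁ k l y x + Y₁ k l z x := by
    ext j
    exact der_add hl hy hz (by omega) hx
  simp [JY₁, this]

lemma Y₀_smul {k : ℕ} {l : ℝ} (c : ℂ) (y : ℝ → ℂ) (x : ℝ) :
    Y₀ k l (c • y) x = c • Y₀ k l y x := by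
  ext j
  exact der_smul c y j x

lemma JY₁_smul {k : ℕ} {l : ℝ} (c : ℂ) (y : ℝ → ℂ) (x : ℝ) :
    JY₁ k l (c • y) x = c • JY₁ k l y x := by
  have : Y₁ k l (c • y) x = c • Y₁ k l y x := by
    ext j
    exact der_smul c y (k + j) x
  simp [JY₁, this]

lemma BoundaryConditions.add {k : ℕ} {l : ℝ} (hl : 0 < l) {V W : E k →L[ℂ] E k}
    {y z : ℝ → ℂ} (hy : IsSobolev (2 * k) l y) (hz : IsSobolev (2 * k) l z)
    (bcy : BoundaryConditions k l V W y) (bcz : BoundaryConditions k l V W z) :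
    BoundaryConditions k l V W (y + z) := by
  have h0 : (0 : ℝ) ∈ Icc 0 l := left_mem_Icc.2 hl.le
  have h1 : l ∈ Icc 0 l := right_mem_Icc.2 hl.le
  constructor
  · rw [Y₀_add hl hy hz h0, Y₀_add hl hy hz h1, JY₁_add hl hy hz h0, smul_add, bcy.fst, bcz.fst]
    simp only [map_add, smul_add]
    abel
  · rw [JY₁_add hl hy hz h1, Y₀_add hl hy hz h0, JY₁_add hl hy hz h0, smul_add, bcy.snd, bcz.snd]
    simp only [map_add, smul_add]
    abel

lemma BoundaryConditions.smul {k : ℕ} {l : ℝ} {V W : E k →L[ℂ] E k} (c : ℂ) {y : ℝ → ℂ}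
    (hy : BoundaryConditions k l V W y) : BoundaryConditions k l V W (c • y) := by
  constructor
  · rw [Y₀_smul, Y₀_smul, JY₁_smul, smul_comm, hy.fst]
    simp only [map_smul, smul_add, smul_comm c Complex.I]
  · rw [JY₁_smul, Y₀_smul, JY₁_smul, smul_comm, hy.snd]
    simp only [map_smul, smul_add, smul_comm c Complex.I]

lemma BoundaryConditions.zero {k : ℕ} {l : ℝ} {V W : E k →L[ℂ] E k} :
    BoundaryConditions k l V W 0 := by
  have h0 (x : ℝ) : Y₀ k l 0 x = 0 := by simpa using Y₀_smul (k := k) (l := l) 0 0 x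
  have h1 (x : ℝ) : JY₁ k l 0 x = 0 := by simpa using JY₁_smul (k := k) (l := l) 0 0 x
  constructor <;> simp [h0, h1]

/-- Two functions in the Sobolev class that agree almost everywhere agree on `[0, l]`. -/
lemma IsSobolev.eqOn {p : ℕ} {l : ℝ} (hl : 0 < l) {y z : ℝ → ℂ}
    (hy : IsSobolev p l y) (hz : IsSobolev p l z) (h : y =ᵐ[μ l] z) : EqOn y z (Icc 0 l) := by
  have h' : y =ᵐ[volume.restrict (Icc 0 l)] z := by
    rwa [← restrict_Ioo_eq_restrict_Icc]
  exact Measure.eqOn_Icc_of_ae_eq volume hl.ne h' hy.contDiffOn.continuousOn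
    hz.contDiffOn.continuousOn

/-- The highest derivative does not depend on the representative. -/
lemma IsSobolev.der_congr {p : ℕ} {l : ℝ} (hl : 0 < l) {y z : ℝ → ℂ}
    (hy : IsSobolev p l y) (hz : IsSobolev p l z) (h : y =ᵐ[μ l] z) :
    der l p y =ᵐ[μ l] der l p z := by
  filter_upwards [ae_restrict_mem measurableSet_Ioo] with x hx
  exact iteratedDerivWithin_congr (hy.eqOn hl hz h) (Ioo_subset_Icc_self hx)

/-! ### The operator -/

/-- The functions of `L²(0, l)` that are `2k` times differentiable in the `L²` sense and satisfy
the boundary conditions. -/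
def dom (k : ℕ) (hk : 0 < k) (l : ℝ) (hl : 0 < l) (V W : E k →L[ℂ] E k) :
    Submodule ℂ (H l) where
  carrier := {f | ∃ y : ℝ → ℂ,
    IsSobolev (2 * k) l y ∧ BoundaryConditions k l V W y ∧ f =ᵐ[μ l] y}
  zero_mem' := ⟨0, .zero, .zero, Lp.coeFn_zero ℂ 2 (μ l)⟩
  add_mem' := by
    rintro f g ⟨y, hy, bcy, hf⟩ ⟨z, hz, bcz, hg⟩
    exact ⟨y + z, hy.add (by omega) hl hz, bcy.add hl hy hz bcz,
      (Lp.coeFn_add f g).trans (hf.add hg)⟩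
  smul_mem' := by
    rintro c f ⟨y, hy, bcy, hf⟩
    exact ⟨c • y, hy.smul c, bcy.smul c, (Lp.coeFn_smul c f).trans (hf.const_smul c)⟩

/-- The value `(-iD)^(2k) f = (-i)^(2k) y^(2k)`, where `y` is the representative of `f` in the
Sobolev class. -/
def opFun (k : ℕ) (hk : 0 < k) (l : ℝ) (hl : 0 < l) (V W : E k →L[ℂ] E k)
    (f : dom k hk l hl V W) : H l :=
  (-Complex.I) ^ (2 * k) • (Classical.choose_spec f.2).1.memLp.toLp

/-- `opFun` is computed by every representative in the Sobolev class. -/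
lemma opFun_eq {k : ℕ} {hk : 0 < k} {l : ℝ} {hl : 0 < l} {V W : E k →L[ℂ] E k}
    (f : dom k hk l hl V W) {y : ℝ → ℂ} (hy : IsSobolev (2 * k) l y)
    (h : (f : H l) =ᵐ[μ l] y) :
    opFun k hk l hl V W f = (-Complex.I) ^ (2 * k) • hy.memLp.toLp := by
  have hs := Classical.choose_spec f.2
  unfold opFun
  congr 1
  exact (MemLp.toLp_eq_toLp_iff _ _).2 (hs.1.der_congr hl hy (hs.2.2.symm.trans h))

/-- The operator `(-iD)^(2k)` in `L²(0, l)` on the domain given by the boundary conditions. -/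
def op (k : ℕ) (hk : 0 < k) (l : ℝ) (hl : 0 < l) (V W : E k →L[ℂ] E k) :
    H l →ₗ.[ℂ] H l where
  domain := dom k hk l hl V W
  toFun :=
    { toFun := opFun k hk l hl V W
      map_add' := by
        intro f g
        obtain ⟨y, hy, -, hf⟩ := f.2
        obtain ⟨z, hz, -, hg⟩ := g.2
        have hp : 0 < 2 * k := by omega
        have hs : ((f + g : dom k hk l hl V W) : H l) =ᵐ[μ l] y + z :=
          (Lp.coeFn_add (f : H l) (g : H l)).trans (hf.add hg)
        rw [opFun_eq f hy hf, opFun_eq g hz hg, opFun_eq (f + g) (hy.add hp hl hz) hs, ← smul_add,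
          ← MemLp.toLp_add]
        congr 1
        exact (MemLp.toLp_eq_toLp_iff _ _).2 (der_add_ae hp hl hy hz)
      map_smul' := by
        intro c f
        obtain ⟨y, hy, -, hf⟩ := f.2
        have hs : ((c • f : dom k hk l hl V W) : H l) =ᵐ[μ l] c • y :=
          (Lp.coeFn_smul c (f : H l)).trans (hf.const_smul c)
        have ht : (hy.smul c).memLp.toLp = c • hy.memLp.toLp :=
          (MemLp.toLp_congr _ (hy.memLp.const_smul c)
            (Eventually.of_forall fun x => der_smul c y (2 * k) x)).trans
              (MemLp.toLp_const_smul c hy.memLp)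
        rw [opFun_eq f hy hf, opFun_eq (c • f) (hy.smul c) hs, RingHom.id_apply, smul_comm c, ht] }

/-- `op` acts as `(-i)^(2k) y^(2k)` on every `f` with Sobolev representative `y`. -/
lemma op_apply {k : ℕ} {hk : 0 < k} {l : ℝ} {hl : 0 < l} {V W : E k →L[ℂ] E k}
    (f : (op k hk l hl V W).domain) {y : ℝ → ℂ} (hy : IsSobolev (2 * k) l y)
    (h : (f : H l) =ᵐ[μ l] y) :
    op k hk l hl V W f = (-Complex.I) ^ (2 * k) • hy.memLp.toLp :=
  opFun_eq f hy h

end UnseparatedBVP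

end

noncomputable section

namespace UnseparatedBVP

open MeasureTheory Set Filter Topology ComplexConjugate

/-! ### Absolutely continuous complex-valued functions -/

/-! Green's formula turns `⟨z, y^(p)⟩ - (-1)^p ⟨z^(p), y⟩` into the difference of a boundary form at
`l` and at `0` (`green_inner`). For `p = 2k`, in the coordinates `Y± = Y₀ ± i J Y₁`, `2i` times this
form is `⟨Y₊, Y₊⟩ - ⟨Y₋, Y₋⟩` (`two_I_mul_bdryForm`), and the boundary conditions decouple into
`Y₊(l) = V Y₊(0)`, `Y₋(l) = W Y₋(0)` (`boundaryConditions_iff`). Unitarity makes the two boundary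
terms cancel, so the operator is symmetric.

Conversely, let `w` lie in the domain of the adjoint. Testing against functions whose boundary data
all vanish shows that `w` has a weak `2k`-th derivative in `L²`, hence is a Sobolev function
(`exists_isSobolev_of_weak`). Testing against the whole domain, where `Y±(0)` can be arbitrary
(`exists_isSobolev_Yp_Ym`), then forces the boundary conditions on `w`. Density also follows from
the weak derivative lemma. -/

lemma absCont_of_dist_le {X Y : Type*} [PseudoMetricSpace X] [PseudoMetricSpace Y]
    {f : ℝ → X} {g : ℝ → Y} {a b : ℝ} (hf : AbsolutelyContinuousOnInterval f a b)
    (h : ∀ s t, dist (g s) (g t) ≤ dist (f s) (f t)) :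
    AbsolutelyContinuousOnInterval g a b := by
  rw [absolutelyContinuousOnInterval_iff] at hf ⊢
  intro ε hε
  obtain ⟨δ, hδ, H⟩ := hf ε hε
  exact ⟨δ, hδ, fun P hP hs => (Finset.sum_le_sum fun i _ => h _ _).trans_lt (H P hP hs)⟩

lemma absCont_conj {f : ℝ → ℂ} {a b : ℝ} (hf : AbsolutelyContinuousOnInterval f a b) :
    AbsolutelyContinuousOnInterval (fun x => conj (f x)) a b :=
  absCont_of_dist_le hf fun s t => by simp [Complex.dist_conj_conj]

lemma absCont_sum {ι : Type*} (s : Finset ι) {f : ι → ℝ → ℂ} {a b : ℝ}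
    (hf : ∀ i ∈ s, AbsolutelyContinuousOnInterval (f i) a b) :
    AbsolutelyContinuousOnInterval (fun x => ∑ i ∈ s, f i x) a b := by
  classical
  induction s using Finset.induction_on with
  | empty =>
    simp only [Finset.sum_empty, absolutelyContinuousOnInterval_iff]
    exact fun ε hε => ⟨1, one_pos, fun _ _ _ => by simpa using hε⟩
  | insert i s hi ih =>
    simp only [Finset.sum_insert hi]
    exact (hf i (Finset.mem_insert_self i s)).fun_add
      (ih fun j hj => hf j (Finset.mem_insert_of_mem hj))

lemma absCont_integral {f : ℝ → ℂ} {a b c : ℝ} (hf : IntervalIntegrable f volume a b)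
    (hc : c ∈ uIcc a b) : AbsolutelyContinuousOnInterval (fun x => ∫ t in c..x, f t) a b := by
  have hre : IntervalIntegrable (fun t => (f t).re) volume a b := ⟨hf.1.re, hf.2.re⟩
  have him : IntervalIntegrable (fun t => (f t).im) volume a b := ⟨hf.1.im, hf.2.im⟩
  have h1 := hre.absolutelyContinuousOnInterval_intervalIntegral hc
  have h2 := him.absolutelyContinuousOnInterval_intervalIntegral hc
  have h1' : AbsolutelyContinuousOnInterval (fun x => ((∫ t in c..x, (f t).re : ℝ) : ℂ)) a b :=
    absCont_of_dist_le h1 fun s t => by simp [Complex.dist_eq, Real.dist_eq, ← Complex.ofReal_sub]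
  have h2' : AbsolutelyContinuousOnInterval (fun x => ((∫ t in c..x, (f t).im : ℝ) : ℂ)) a b :=
    absCont_of_dist_le h2 fun s t => by simp [Complex.dist_eq, Real.dist_eq, ← Complex.ofReal_sub]
  refine absCont_congr (h1'.fun_add (h2'.const_smul Complex.I)) fun x hx => ?_
  have hsub : uIcc c x ⊆ uIcc a b := uIcc_subset_uIcc hc hx
  have hr := hre.mono_set hsub
  have hi := him.mono_set hsub
  simp only [smul_eq_mul]
  rw [← intervalIntegral.integral_ofReal, ← intervalIntegral.integral_ofReal,
    ← intervalIntegral.integral_const_mul, ← intervalIntegral.integral_add]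
  · exact intervalIntegral.integral_congr fun t _ => by
      simp [mul_comm Complex.I, Complex.re_add_im]
  · exact ⟨hr.1.ofReal, hr.2.ofReal⟩
  · exact IntervalIntegrable.const_mul ⟨hi.1.ofReal, hi.2.ofReal⟩ _

/-- The fundamental theorem of calculus for absolutely continuous complex functions. -/
lemma absCont_integral_eq_sub {F g : ℝ → ℂ} {a b : ℝ} (hab : a ≤ b)
    (hF : AbsolutelyContinuousOnInterval F a b) (hg : IntervalIntegrable g volume a b)
    (h : ∀ᵐ x, x ∈ Ioo a b → HasDerivAt F (g x) x) :
    ∫ x in a..b, g x = F b - F a := by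
  -- The difference of `F` and the integral of `g` has derivative zero almost everywhere, so
  -- absolute continuity makes it constant.
  have hd : AbsolutelyContinuousOnInterval (fun x => F x - ∫ t in a..x, g t) a b :=
    hF.fun_sub (absCont_integral hg left_mem_uIcc)
  have h0 : ∀ᵐ x, x ∈ uIcc a b → HasDerivAt (fun x => F x - ∫ t in a..x, g t) 0 x := by
    have ha : ∀ᵐ x : ℝ, x ≠ a := by simp [ae_iff]
    have hb : ∀ᵐ x : ℝ, x ≠ b := by simp [ae_iff]
    filter_upwards [h, hg.ae_hasDerivAt_integral, ha, hb] with x h1 h2 hxa hxb hx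
    have hx' := hx
    rw [uIcc_of_le hab] at hx'
    have := (h1 ⟨lt_of_le_of_ne hx'.1 hxa.symm, lt_of_le_of_ne hx'.2 hxb⟩).fun_sub
      (h2 hx a left_mem_uIcc)
    simpa using this
  obtain ⟨C, hC⟩ := hd.const_of_ae_hasDerivAt_zero h0
  have e1 := hC a left_mem_uIcc
  have e2 := hC b right_mem_uIcc
  simp only [intervalIntegral.integral_same, sub_zero] at e1
  rw [e1, ← e2]
  ring

/-! ### Derivatives of Sobolev functions -/

variable {p : ℕ} {l : ℝ}

lemma memLp_of_continuousOn {f : ℝ → ℂ} (hf : ContinuousOn f (Icc 0 l)) : MemLp f 2 (μ l) := by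
  obtain ⟨C, hC⟩ := isCompact_Icc.exists_bound_of_continuousOn hf
  refine MemLp.of_bound ((hf.mono Ioo_subset_Icc_self).aestronglyMeasurable measurableSet_Ioo) C ?_
  filter_upwards [ae_restrict_mem measurableSet_Ioo] with x hx
  exact hC x (Ioo_subset_Icc_self hx)

/-- Order `p - 1` is absolutely continuous by definition; lower orders are `C¹` on a compact
interval. -/
lemma IsSobolev.absCont_der (hl : 0 < l) {y : ℝ → ℂ} (hy : IsSobolev p l y) {j : ℕ} (hj : j < p) :
    AbsolutelyContinuousOnInterval (der l j y) 0 l := by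
  rcases (Nat.le_sub_one_of_lt hj).eq_or_lt with rfl | h
  · exact hy.absCont
  · apply ContDiffOn.absolutelyContinuousOnInterval
    rw [uIcc_of_le hl.le]
    have := hy.contDiffOn.of_le (m := ((j + 1 : ℕ) : WithTop ℕ∞)) (by exact_mod_cast h)
    exact ((contDiffOn_nat_succ_iff_contDiffOn_one_iteratedDerivWithin
      (uniqueDiffOn_Icc hl)).1 this).2

lemma IsSobolev.continuousOn_der (hl : 0 < l) {y : ℝ → ℂ} (hy : IsSobolev p l y) {j : ℕ}
    (hj : j < p) : ContinuousOn (der l j y) (Icc 0 l) := by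
  simpa [uIcc_of_le hl.le] using (hy.absCont_der hl hj).continuousOn

lemma IsSobolev.memLp_der (hl : 0 < l) {y : ℝ → ℂ} (hy : IsSobolev p l y) {j : ℕ}
    (hj : j ≤ p) : MemLp (der l j y) 2 (μ l) := by
  rcases hj.eq_or_lt with rfl | h
  · exact hy.memLp
  · exact memLp_of_continuousOn (hy.continuousOn_der hl h)

lemma IsSobolev.memLp_self (hl : 0 < l) {y : ℝ → ℂ} (hy : IsSobolev p l y) :
    MemLp y 2 (μ l) := by
  simpa using hy.memLp_der hl (Nat.zero_le p)

lemma IsSobolev.hasDerivAt_der (hl : 0 < l) {y : ℝ → ℂ} (hy : IsSobolev p l y) {j : ℕ}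
    (hj : j < p) : ∀ᵐ x, x ∈ Ioo 0 l → HasDerivAt (der l j y) (der l (j + 1) y x) x := by
  filter_upwards [(hy.absCont_der hl hj).boundedVariationOn.ae_differentiableAt_of_mem_uIcc]
    with x h hx
  have hd := h (by rw [uIcc_of_le hl.le]; exact Ioo_subset_Icc_self hx)
  have : der l (j + 1) y x = deriv (der l j y) x := by
    rw [der, iteratedDerivWithin_succ, derivWithin_of_mem_nhds (Icc_mem_nhds hx.1 hx.2)]
  rw [this]
  exact hd.hasDerivAt

/-! ### Green's formula -/

/-- The boundary form of `D^p`. -/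
def bdryForm (p : ℕ) (l : ℝ) (y z : ℝ → ℂ) (x : ℝ) : ℂ :=
  ∑ j ∈ Finset.range p, (-1) ^ j * (der l (p - 1 - j) y x * conj (der l j z x))

/-- The derivative of each summand of `bdryForm` is a difference of two consecutive terms, so the
sum telescopes almost everywhere to the integrand; absolute continuity permits integrating it back.
-/
lemma green (hl : 0 < l) {y z : ℝ → ℂ} (hy : IsSobolev p l y) (hz : IsSobolev p l z) :
    ∫ x, (der l p y x * conj (der l 0 z x) - (-1) ^ p * (der l 0 y x * conj (der l p z x))) ∂(μ l)
      = bdryForm p l y z l - bdryForm p l y z 0 := by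
  have hI : ∀ {i j : ℕ}, i ≤ p → j ≤ p →
      Integrable (fun x => der l i y x * conj (der l j z x)) (μ l) := fun hi hj =>
    (hy.memLp_der hl hi).integrable_mul (hz.memLp_der hl hj).star
  have hint : Integrable (fun x => der l p y x * conj (der l 0 z x)
      - (-1) ^ p * (der l 0 y x * conj (der l p z x))) (μ l) :=
    (hI le_rfl (Nat.zero_le p)).sub ((hI (Nat.zero_le p) le_rfl).const_mul _)
  rw [← integral_Ioc_eq_integral_Ioo, ← intervalIntegral.integral_of_le hl.le]
  apply absCont_integral_eq_sub (F := bdryForm p l y z) hl.le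
  · apply absCont_sum
    intro j hj
    rw [Finset.mem_range] at hj
    exact ((hy.absCont_der hl (by omega)).fun_smul
      (absCont_conj (hz.absCont_der hl hj))).const_smul ((-1 : ℂ) ^ j)
  · rwa [intervalIntegrable_iff_integrableOn_Ioo_of_le hl.le]
  · have hy' : ∀ᵐ x, ∀ j < p, x ∈ Ioo 0 l → HasDerivAt (der l j y) (der l (j + 1) y x) x :=
      ae_all_iff.2 fun j => by
        by_cases hj : j < p
        · filter_upwards [hy.hasDerivAt_der hl hj] with x hx _ using hx
        · simp [hj]
    have hz' : ∀ᵐ x, ∀ j < p, x ∈ Ioo 0 l → HasDerivAt (der l j z) (der l (j + 1) z x) x :=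
      ae_all_iff.2 fun j => by
        by_cases hj : j < p
        · filter_upwards [hz.hasDerivAt_der hl hj] with x hx _ using hx
        · simp [hj]
    filter_upwards [hy', hz'] with x h1 h2 hx
    have key : HasDerivAt (bdryForm p l y z) (∑ j ∈ Finset.range p,
        ((-1) ^ j * (der l (p - j) y x * conj (der l j z x))
          - (-1) ^ (j + 1) * (der l (p - (j + 1)) y x * conj (der l (j + 1) z x)))) x := by
      apply HasDerivAt.fun_sum
      intro j hj
      rw [Finset.mem_range] at hj
      have e1 := h1 (p - 1 - j) (by omega) hx
      have e2 := (h2 j hj hx).star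
      have e : p - 1 - j + 1 = p - j := by omega
      have e' : p - (j + 1) = p - 1 - j := by omega
      rw [e] at e1
      rw [e']
      convert! (e1.mul e2).const_mul ((-1 : ℂ) ^ j) using 1
      simp only [Complex.star_def]
      ring
    rw [Finset.sum_range_sub' (fun j => (-1 : ℂ) ^ j * (der l (p - j) y x * conj (der l j z x)))]
      at key
    simpa using key

lemma green_inner (hl : 0 < l) {y z : ℝ → ℂ} (hy : IsSobolev p l y)
    (hz : IsSobolev p l z) {f g f' g' : H l} (hf : f =ᵐ[μ l] y) (hg : g =ᵐ[μ l] z)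
    (hf' : f' =ᵐ[μ l] der l p y) (hg' : g' =ᵐ[μ l] der l p z) :
    inner ℂ g f' - (-1) ^ p * inner ℂ g' f = bdryForm p l y z l - bdryForm p l y z 0 := by
  rw [← green hl hy hz, L2.inner_def, L2.inner_def, ← integral_const_mul, ← integral_sub]
  · apply integral_congr_ae
    filter_upwards [hf, hg, hf', hg'] with x h1 h2 h3 h4
    simp [h1, h2, h3, h4]
  · exact L2.integrable_inner g f'
  · exact (L2.integrable_inner g' f).const_mul _

/-! ### Antiderivatives -/

lemma isSobolev_one_integral (hl : 0 < l) {f : ℝ → ℂ} (hf : MemLp f 2 (μ l)) :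
    IsSobolev 1 l (fun x => ∫ t in (0 : ℝ)..x, f t) ∧
      der l 1 (fun x => ∫ t in (0 : ℝ)..x, f t) =ᵐ[μ l] f := by
  have hi : IntervalIntegrable f volume 0 l := by
    rw [intervalIntegrable_iff_integrableOn_Ioo_of_le hl.le]
    exact hf.integrable one_le_two
  have hac := absCont_integral hi left_mem_uIcc
  have hd : der l 1 (fun x => ∫ t in (0 : ℝ)..x, f t) =ᵐ[μ l] f := by
    rw [EventuallyEq, ae_restrict_iff' measurableSet_Ioo]
    filter_upwards [hi.ae_hasDerivAt_integral] with x hx hx'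
    rw [der, iteratedDerivWithin_one, derivWithin_of_mem_nhds (Icc_mem_nhds hx'.1 hx'.2)]
    exact (hx (by rw [uIcc_of_le hl.le]; exact Ioo_subset_Icc_self hx') 0 left_mem_uIcc).deriv
  refine ⟨⟨?_, ?_, (memLp_congr_ae hd).2 hf⟩, hd⟩
  · have := hac.continuousOn
    rw [uIcc_of_le hl.le] at this
    simpa using (contDiffOn_zero (𝕜 := ℝ)).2 this
  · simpa using hac

lemma hasDerivWithinAt_integral {h : ℝ → ℂ} (hh : ContinuousOn h (Icc 0 l)) {t : ℝ}
    (ht : t ∈ Icc 0 l) :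
    HasDerivWithinAt (fun x => ∫ t in (0 : ℝ)..x, h t) (h t) (Icc 0 l) t := by
  have : Fact (t ∈ Icc 0 l) := ⟨ht⟩
  have hsub : uIcc 0 t ⊆ Icc 0 l := by
    rw [uIcc_of_le ht.1]
    exact Icc_subset_Icc_right ht.2
  exact intervalIntegral.integral_hasDerivWithinAt_right (hh.mono hsub).intervalIntegrable
    (hh.stronglyMeasurableAtFilter_nhdsWithin measurableSet_Icc t) (hh t ht)

lemma der_succ_integral (hl : 0 < l) {h : ℝ → ℂ} (hh : ContinuousOn h (Icc 0 l)) (j : ℕ) {x : ℝ}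
    (hx : x ∈ Icc 0 l) : der l (j + 1) (fun x => ∫ t in (0 : ℝ)..x, h t) x = der l j h x := by
  rw [der, iteratedDerivWithin_succ']
  exact iteratedDerivWithin_congr (fun t ht =>
    (hasDerivWithinAt_integral hh ht).derivWithin (uniqueDiffOn_Icc hl t ht)) hx

/-- Repeated integration from `0`. -/
lemma exists_antiderivative (hl : 0 < l) {f : ℝ → ℂ} (hf : MemLp f 2 (μ l)) (p : ℕ) :
    ∃ y : ℝ → ℂ, IsSobolev (p + 1) l y ∧ (∀ j < p + 1, der l j y 0 = 0) ∧
      der l (p + 1) y =ᵐ[μ l] f := by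
  induction p with
  | zero =>
    refine ⟨_, (isSobolev_one_integral hl hf).1, fun j hj => ?_, (isSobolev_one_integral hl hf).2⟩
    obtain rfl : j = 0 := by omega
    simp
  | succ p ih =>
    obtain ⟨h, hh, h0, hd⟩ := ih
    have hc : ContinuousOn h (Icc 0 l) := hh.contDiffOn.continuousOn
    have hD : ∀ j, EqOn (der l j h) (der l (j + 1) (fun x => ∫ t in (0 : ℝ)..x, h t)) (Icc 0 l) :=
      fun j x hx => (der_succ_integral hl hc j hx).symm
    have hae : der l (p + 1) h =ᵐ[μ l] der l (p + 1 + 1) (fun x => ∫ t in (0 : ℝ)..x, h t) := by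
      filter_upwards [ae_restrict_mem measurableSet_Ioo] with x hx
      exact hD _ (Ioo_subset_Icc_self hx)
    refine ⟨fun x => ∫ t in (0 : ℝ)..x, h t, ⟨?_, ?_, ?_⟩, fun j hj => ?_, hae.symm.trans hd⟩
    · have := hh.contDiffOn
      simp only [Nat.add_sub_cancel] at this ⊢
      push_cast
      rw [contDiffOn_succ_iff_derivWithin (uniqueDiffOn_Icc hl)]
      refine ⟨fun t ht =>
        (hasDerivWithinAt_integral hc ht).differentiableWithinAt,
        fun h => ?_, this.congr fun t ht =>
        (hasDerivWithinAt_integral hc ht).derivWithin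
          (uniqueDiffOn_Icc hl t ht)⟩
      -- The analyticity clause of the criterion concerns only order `ω` and is void for a finite
      -- order.
      exact absurd h (by exact_mod_cast WithTop.coe_ne_top)
    · refine absCont_congr hh.absCont ?_
      rw [uIcc_of_le hl.le]
      exact hD p
    · exact (memLp_congr_ae hae).1 hh.memLp
    · cases j with
      | zero => simp
      | succ j =>
        rw [← hD j (left_mem_Icc.2 hl.le)]
        exact h0 j (by omega)

/-! ### Smooth functions and monomials -/

lemma isSobolev_of_contDiff (hl : 0 < l) {y : ℝ → ℂ} (hy : ContDiff ℝ (⊤ : ℕ∞) y) (p : ℕ) :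
    IsSobolev p l y := by
  have hc : ∀ n : ℕ, ContDiffOn ℝ n y (Icc 0 l) := fun n =>
    (hy.of_le (by exact_mod_cast le_top)).contDiffOn
  refine ⟨hc _, ?_, memLp_of_continuousOn
    ((hc p).continuousOn_iteratedDerivWithin le_rfl (uniqueDiffOn_Icc hl))⟩
  apply ContDiffOn.absolutelyContinuousOnInterval
  rw [uIcc_of_le hl.le]
  exact ((contDiffOn_nat_succ_iff_contDiffOn_one_iteratedDerivWithin
    (uniqueDiffOn_Icc hl)).1 (hc (p - 1 + 1))).2

/-- The normalised monomial `(x - a)^m / m!`. -/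
def mono (a : ℝ) (m : ℕ) (x : ℝ) : ℂ := ((x - a : ℝ) : ℂ) ^ m / m.factorial

lemma contDiff_mono (a : ℝ) (m : ℕ) : ContDiff ℝ (⊤ : ℕ∞) (mono a m) := by
  have : ContDiff ℝ (⊤ : ℕ∞) fun x : ℝ => ((x - a : ℝ) : ℂ) :=
    Complex.ofRealCLM.contDiff.comp (contDiff_id.sub contDiff_const)
  exact (this.pow m).div_const _

lemma mono_self (a : ℝ) (m : ℕ) : mono a m a = if m = 0 then 1 else 0 := by
  cases m <;> simp [mono]

lemma deriv_mono_succ (a : ℝ) (m : ℕ) : deriv (mono a (m + 1)) = mono a m := by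
  funext x
  have h : HasDerivAt (fun x : ℝ => ((x - a : ℝ) : ℂ)) 1 x := by
    simpa using ((hasDerivAt_id x).sub_const a).ofReal_comp
  have := (h.pow (m + 1)).div_const (((m + 1).factorial : ℕ) : ℂ)
  have e : mono a (m + 1) = fun x : ℝ => ((x - a : ℝ) : ℂ) ^ (m + 1) / ((m + 1).factorial : ℂ) := rfl
  rw [e]
  refine this.deriv.trans ?_
  have h1 : (m.factorial : ℂ) ≠ 0 := by exact_mod_cast m.factorial_ne_zero
  have h2 : ((m : ℂ) + 1) ≠ 0 := by exact_mod_cast m.succ_ne_zero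
  simp only [mono, Nat.factorial_succ, Nat.cast_mul, Nat.cast_succ, Nat.add_sub_cancel]
  field_simp

lemma deriv_mono_zero (a : ℝ) : deriv (mono a 0) = 0 := by
  have : mono a 0 = fun _ => 1 := by
    funext x
    simp [mono]
  rw [this]
  funext x
  simp

lemma iteratedDeriv_mono (a : ℝ) (m j : ℕ) :
    iteratedDeriv j (mono a m) = if j ≤ m then mono a (m - j) else 0 := by
  induction j generalizing m with
  | zero => simp
  | succ j ih =>
    rw [iteratedDeriv_succ']
    cases m with
    | zero =>
      rw [deriv_mono_zero]
      funext x
      simp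
    | succ m => simp [deriv_mono_succ, ih]

lemma der_eq_iteratedDeriv (hl : 0 < l) {y : ℝ → ℂ} (hy : ContDiff ℝ (⊤ : ℕ∞) y) (j : ℕ) {x : ℝ}
    (hx : x ∈ Icc 0 l) : der l j y x = iteratedDeriv j y x :=
  iteratedDerivWithin_eq_iteratedDeriv (uniqueDiffOn_Icc hl)
    (hy.of_le (by exact_mod_cast le_top)).contDiffAt hx

/-- The monomials at `a` are dual to the functionals `y ↦ y^(j)(a)`, which serves both to prescribe
derivatives and to read them off the boundary form. -/
lemma der_mono_self (hl : 0 < l) {a : ℝ} (ha : a ∈ Icc 0 l) (m j : ℕ) :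
    der l j (mono a m) a = if j = m then 1 else 0 := by
  rw [der_eq_iteratedDeriv hl (contDiff_mono a m) j ha, iteratedDeriv_mono]
  split_ifs with h1 h2 h2
  · subst h2
    simp [mono]
  · rw [mono_self, if_neg (by omega)]
  · omega
  · rfl

lemma der_mono_of_lt (hl : 0 < l) (a : ℝ) {m j : ℕ} (h : m < j) {x : ℝ} (hx : x ∈ Icc 0 l) :
    der l j (mono a m) x = 0 := by
  rw [der_eq_iteratedDeriv hl (contDiff_mono a m) j hx, iteratedDeriv_mono, if_neg (by omega)]
  rfl

/-! ### Interpolation of boundary data -/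

/-- A multiple of `mono a p` corrects the `p`-th derivative at `a` and leaves the lower ones
unchanged. -/
lemma exists_contDiff_der_eq (hl : 0 < l) {a : ℝ} (ha : a ∈ Icc 0 l) (p : ℕ) (α : ℕ → ℂ) :
    ∃ y : ℝ → ℂ, ContDiff ℝ (⊤ : ℕ∞) y ∧ ∀ j < p, der l j y a = α j := by
  induction p with
  | zero => exact ⟨0, contDiff_const, by simp⟩
  | succ p ih =>
    obtain ⟨y, hy, h⟩ := ih
    have hs := isSobolev_of_contDiff hl hy (p + 1)
    have hm : IsSobolev (p + 1) l ((α p - der l p y a) • mono a p) :=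
      (isSobolev_of_contDiff hl (contDiff_mono a p) (p + 1)).smul _
    refine ⟨y + (α p - der l p y a) • mono a p, hy.add ((contDiff_mono a p).const_smul (α p - der l p y a)),
      fun j hj => ?_⟩
    rw [der_add hl hs hm hj ha, der_smul, der_mono_self hl ha]
    rcases (Nat.lt_succ_iff.1 hj).eq_or_lt with rfl | hlt
    · simp
    · simp [hlt.ne, h j hlt]

lemma exists_isSobolev_der_eq (hl : 0 < l) (p : ℕ) (α β : ℕ → ℂ) :
    ∃ y : ℝ → ℂ, IsSobolev p l y ∧ ∀ j < p, der l j y 0 = α j ∧ der l j y l = β j := by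
  have h0 : (0 : ℝ) ∈ Icc 0 l := left_mem_Icc.2 hl.le
  have h1 : l ∈ Icc 0 l := right_mem_Icc.2 hl.le
  obtain ⟨u, hu, hα⟩ := exists_contDiff_der_eq hl h0 p α
  obtain ⟨v, hv, hβ⟩ := exists_contDiff_der_eq hl h1 p β
  -- The cutoff vanishes for `x ≤ l/3` and equals `1` for `x ≥ 2l/3`, so the glued function is `u`
  -- near `0` and `v` near `l`.
  let φ : ℝ → ℝ := fun x => Real.smoothTransition (3 / l * x - 1)
  have hφ : ContDiff ℝ (⊤ : ℕ∞) fun x => (φ x : ℂ) :=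
    Complex.ofRealCLM.contDiff.comp (Real.smoothTransition.contDiff.comp
      ((contDiff_const.mul contDiff_id).sub contDiff_const))
  have e0 : (fun x => (1 - (φ x : ℂ)) * u x + φ x * v x) =ᶠ[𝓝 0] u := by
    filter_upwards [Iio_mem_nhds (show (0 : ℝ) < l / 3 by positivity)] with x hx
    have : φ x = 0 := Real.smoothTransition.zero_of_nonpos (by
      have : 3 / l * x ≤ 3 / l * (l / 3) := by gcongr; exact le_of_lt hx
      have e : 3 / l * (l / 3) = 1 := by field_simp
      linarith)
    simp [this]
  have e1 : (fun x => (1 - (φ x : ℂ)) * u x + φ x * v x) =ᶠ[𝓝 l] v := by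
    filter_upwards [Ioi_mem_nhds (show 2 * l / 3 < l by linarith)] with x hx
    have : φ x = 1 := Real.smoothTransition.one_of_one_le (by
      have : 3 / l * (2 * l / 3) ≤ 3 / l * x := by gcongr; exact le_of_lt hx
      have e : 3 / l * (2 * l / 3) = 2 := by field_simp
      linarith)
    simp [this]
  refine ⟨fun x => (1 - (φ x : ℂ)) * u x + φ x * v x,
    isSobolev_of_contDiff hl (((contDiff_const.sub hφ).mul hu).add (hφ.mul hv)) p, fun j hj => ?_⟩
  rw [← hα j hj, ← hβ j hj]
  exact ⟨(e0.filter_mono nhdsWithin_le_nhds).iteratedDerivWithin_eq e0.self_of_nhds,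
    (e1.filter_mono nhdsWithin_le_nhds).iteratedDerivWithin_eq e1.self_of_nhds⟩

/-! ### The minimal operator -/

/-- Membership in the domain of the minimal operator. -/
structure IsSobolevZero (p : ℕ) (l : ℝ) (y : ℝ → ℂ) : Prop extends IsSobolev p l y where
  left : ∀ j < p, der l j y 0 = 0
  right : ∀ j < p, der l j y l = 0

lemma bdryForm_eq_zero {y : ℝ → ℂ} {x : ℝ} (h : ∀ j < p, der l j y x = 0) (z : ℝ → ℂ) :
    bdryForm p l y z x = 0 :=
  Finset.sum_eq_zero fun j hj => by
    rw [h (p - 1 - j) (by rw [Finset.mem_range] at hj; omega)]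
    simp

lemma bdryForm_mono (hl : 0 < l) (y : ℝ → ℂ) {m : ℕ} (hm : m < p) :
    bdryForm p l y (mono l m) l = (-1) ^ m * der l (p - 1 - m) y l := by
  rw [bdryForm, Finset.sum_eq_single m]
  · simp [der_mono_self hl (right_mem_Icc.2 hl.le)]
  · intro j _ hj
    simp [der_mono_self hl (right_mem_Icc.2 hl.le), hj]
  · simp [hm]

/-- The monomials as elements of `L²(0, l)`. -/
def monoLp (hl : 0 < l) (m : ℕ) : H l :=
  (isSobolev_of_contDiff hl (contDiff_mono l m) 1).memLp_self hl |>.toLp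

lemma monoLp_coe (hl : 0 < l) (m : ℕ) : monoLp hl m =ᵐ[μ l] mono l m := MemLp.coeFn_toLp _

/-- Polynomials of degree less than `p`. -/
def polyLp (hl : 0 < l) (p : ℕ) : Submodule ℂ (H l) :=
  Submodule.span ℂ (range fun m : Fin p => monoLp hl m)

instance (hl : 0 < l) (p : ℕ) : FiniteDimensional ℂ (polyLp hl p) :=
  FiniteDimensional.span_of_finite ℂ (finite_range _)

lemma exists_isSobolev_of_mem_polyLp (hp : 0 < p) (hl : 0 < l) {f : H l} (hf : f ∈ polyLp hl p) :
    ∃ y : ℝ → ℂ, IsSobolev p l y ∧ f =ᵐ[μ l] y ∧ der l p y =ᵐ[μ l] 0 := by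
  induction hf using Submodule.span_induction with
  | mem f hf =>
    obtain ⟨m, rfl⟩ := hf
    refine ⟨mono l m, isSobolev_of_contDiff hl (contDiff_mono l m) p, monoLp_coe hl m, ?_⟩
    filter_upwards [ae_restrict_mem measurableSet_Ioo] with x hx
    exact der_mono_of_lt hl l m.2 (Ioo_subset_Icc_self hx)
  | zero =>
    exact ⟨0, .zero, Lp.coeFn_zero ℂ 2 (μ l), Eventually.of_forall fun x => by simp⟩
  | add f g _ _ hf hg =>
    obtain ⟨y, hy, hfy, hdy⟩ := hf
    obtain ⟨z, hz, hgz, hdz⟩ := hg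
    refine ⟨y + z, hy.add hp hl hz, (Lp.coeFn_add f g).trans (hfy.add hgz),
      (der_add_ae hp hl hy hz).trans ((hdy.add hdz).trans ?_)⟩
    simp
  | smul c f _ hf =>
    obtain ⟨y, hy, hfy, hdy⟩ := hf
    refine ⟨c • y, hy.smul c, (Lp.coeFn_smul c f).trans (hfy.const_smul c), ?_⟩
    filter_upwards [hdy] with x hx
    rw [der_smul, hx]
    simp

/-- Integrate `p` times from `0`. Green's formula against `mono l (p - 1 - j)`, whose `p`-th
derivative vanishes, equates `y^(j)(l)` up to sign with an inner product that is zero by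
orthogonality. -/
lemma exists_isSobolevZero_of_mem_orthogonal (hp : 0 < p) (hl : 0 < l) {f : H l}
    (hf : f ∈ (polyLp hl p)ᗮ) : ∃ y : ℝ → ℂ, IsSobolevZero p l y ∧ der l p y =ᵐ[μ l] f := by
  obtain ⟨q, rfl⟩ : ∃ q, p = q + 1 := ⟨p - 1, by omega⟩
  obtain ⟨y, hy, h0, hd⟩ := exists_antiderivative hl (Lp.memLp f) q
  refine ⟨y, ⟨hy, h0, fun j hj => ?_⟩, hd⟩
  have hm : q - j < q + 1 := by omega
  have hS := isSobolev_of_contDiff hl (contDiff_mono l (q - j)) (q + 1)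
  have hd0 : ((0 : H l) : ℝ → ℂ) =ᵐ[μ l] der l (q + 1) (mono l (q - j)) := by
    filter_upwards [ae_restrict_mem measurableSet_Ioo, Lp.coeFn_zero ℂ 2 (μ l)] with x hx h
    rw [h, der_mono_of_lt hl l hm (Ioo_subset_Icc_self hx)]
    rfl
  have hG := green_inner hl hy hS (hy.memLp_self hl).coeFn_toLp (monoLp_coe hl _) hd.symm hd0
  have hin : inner ℂ (monoLp hl (q - j)) f = 0 :=
    (Submodule.mem_orthogonal _ _).1 hf _ (Submodule.subset_span ⟨⟨q - j, hm⟩, rfl⟩)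
  rw [hin, bdryForm_eq_zero h0, bdryForm_mono hl y hm, inner_zero_left] at hG
  have e : q - (q - j) = j := by omega
  simpa [e] using hG.symm

/-- Weak derivatives against the minimal domain are strong derivatives. -/
lemma exists_isSobolev_of_weak (hp : 0 < p) (hl : 0 < l) {w g : H l}
    (h : ∀ (y : ℝ → ℂ) (f f' : H l), IsSobolevZero p l y → f =ᵐ[μ l] y → f' =ᵐ[μ l] der l p y →
      inner ℂ w f' = (-1) ^ p * inner ℂ g f) :
    ∃ z : ℝ → ℂ, IsSobolev p l z ∧ w =ᵐ[μ l] z ∧ der l p z =ᵐ[μ l] g := by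
  obtain ⟨q, rfl⟩ : ∃ q, p = q + 1 := ⟨p - 1, by omega⟩
  obtain ⟨u, hu, -, hd⟩ := exists_antiderivative hl (Lp.memLp g) q
  let U : H l := (hu.memLp_self hl).toLp
  have hUu : U =ᵐ[μ l] u := MemLp.coeFn_toLp _
  -- Both `w` and the iterated antiderivative `U` have weak derivative `g`, so `w - U` is orthogonal
  -- to `(polyLp hl p)ᗮ`; a finite-dimensional space is its own double orthogonal complement.
  have hmem : w - U ∈ polyLp hl (q + 1) := by
    rw [← Submodule.orthogonal_orthogonal (polyLp hl (q + 1)), Submodule.mem_orthogonal']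
    intro f' hf'
    obtain ⟨y, hy, hyf⟩ := exists_isSobolevZero_of_mem_orthogonal hp hl hf'
    have hyL := (hy.memLp_self hl).coeFn_toLp
    have hG := green_inner hl hy.toIsSobolev hu hyL hUu hyf.symm hd.symm
    rw [bdryForm_eq_zero hy.left, bdryForm_eq_zero hy.right, sub_zero, sub_eq_zero] at hG
    rw [inner_sub_left, hG, h y _ f' hy hyL hyf.symm, sub_self]
  obtain ⟨v, hv, hwv, hdv⟩ := exists_isSobolev_of_mem_polyLp hp hl hmem
  refine ⟨v + u, hv.add hp hl hu, ?_, ?_⟩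
  · filter_upwards [hwv, hUu, Lp.coeFn_sub w U] with x h1 h2 h3
    rw [Pi.add_apply, ← h1, ← h2, h3]
    simp
  · filter_upwards [der_add_ae hp hl hv hu, hdv, hd] with x h1 h2 h3
    simp [h1, h2, h3]

variable {k : ℕ}

/-! ### The boundary form in terms of boundary vectors -/

lemma JY₁_apply (y : ℝ → ℂ) (x : ℝ) (a : Fin k) :
    JY₁ k l y x a = (-1) ^ (a : ℕ) * der l (2 * k - 1 - a) y x := by
  have ha := a.2
  have hv : ((JY₁ k l y x) a : ℂ) = ∑ b : Fin k, J k a b * der l (k + b) y x := rfl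
  rw [hv, Finset.sum_eq_single (⟨k - 1 - a, by omega⟩ : Fin k)]
  · have e : k + (k - 1 - (a : ℕ)) = 2 * k - 1 - a := by omega
    have e' : (a : ℕ) + (k - 1 - a) + 1 = k := by omega
    simp [J, e, e']
  · intro b _ hb
    have : (a : ℕ) + b + 1 ≠ k := fun h => hb (Fin.ext (by simp only; omega))
    simp [J, this]
  · simp

/-- The terms `j < k` give the first inner product. The others, reflected by `j ↦ 2k - 1 - j`, give
the second, with a minus sign because `2k - 1` is odd. -/
lemma bdryForm_eq_inner (y z : ℝ → ℂ) (x : ℝ) :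
    bdryForm (2 * k) l y z x
      = inner ℂ (Y₀ k l z x) (JY₁ k l y x) - inner ℂ (JY₁ k l z x) (Y₀ k l y x) := by
  have h1 : inner ℂ (Y₀ k l z x) (JY₁ k l y x) = ∑ j ∈ Finset.range k,
      (-1) ^ j * (der l (2 * k - 1 - j) y x * conj (der l j z x)) := by
    rw [PiLp.inner_apply, ← Fin.sum_univ_eq_sum_range
      (fun j => (-1 : ℂ) ^ j * (der l (2 * k - 1 - j) y x * conj (der l j z x)))]
    refine Finset.sum_congr rfl fun a _ => ?_
    rw [RCLike.inner_apply, JY₁_apply, mul_assoc]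
    rfl
  have h2 : inner ℂ (JY₁ k l z x) (Y₀ k l y x) = ∑ j ∈ Finset.range k,
      (-1) ^ j * (der l j y x * conj (der l (2 * k - 1 - j) z x)) := by
    rw [PiLp.inner_apply, ← Fin.sum_univ_eq_sum_range
      (fun j => (-1 : ℂ) ^ j * (der l j y x * conj (der l (2 * k - 1 - j) z x)))]
    refine Finset.sum_congr rfl fun a _ => ?_
    rw [RCLike.inner_apply, JY₁_apply]
    simp only [map_mul, map_pow, map_neg, map_one, Y₀]
    ring
  rw [h1, h2, bdryForm, show 2 * k = k + k by ring, Finset.sum_range_add,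
    ← Finset.sum_range_reflect (fun j => (-1 : ℂ) ^ (k + j) * _), sub_eq_add_neg,
    ← Finset.sum_neg_distrib]
  congr 1
  refine Finset.sum_congr rfl fun j hj => ?_
  rw [Finset.mem_range] at hj
  have e1 : k + k - 1 - (k + (k - 1 - j)) = j := by omega
  have e2 : k + (k - 1 - j) = k + k - 1 - j := by omega
  have e3 : (-1 : ℂ) ^ (k + k - 1 - j) = -(-1) ^ j := by
    have : (-1 : ℂ) ^ (k + k - 1 - j) * (-1) ^ (j + 1) = 1 := by
      rw [← pow_add, show k + k - 1 - j + (j + 1) = k + k by omega, ← two_mul, pow_mul]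
      simp
    have h : (-1 : ℂ) ^ j * (-1) ^ j = 1 := by rw [← mul_pow]; simp
    rw [pow_succ] at this
    linear_combination (-(-1 : ℂ) ^ j) * this - (-1 : ℂ) ^ (k + k - 1 - j) * h
  rw [e1, e2, e3]
  ring

/-- `Y₀ + i J Y₁`. -/
def Yp (k : ℕ) (l : ℝ) (y : ℝ → ℂ) (x : ℝ) : E k := Y₀ k l y x + Complex.I • JY₁ k l y x

/-- `Y₀ - i J Y₁`. -/
def Ym (k : ℕ) (l : ℝ) (y : ℝ → ℂ) (x : ℝ) : E k := Y₀ k l y x - Complex.I • JY₁ k l y x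

lemma two_I_mul_bdryForm (y z : ℝ → ℂ) (x : ℝ) :
    2 * Complex.I * bdryForm (2 * k) l y z x
      = inner ℂ (Yp k l z x) (Yp k l y x) - inner ℂ (Ym k l z x) (Ym k l y x) := by
  rw [bdryForm_eq_inner]
  simp only [Yp, Ym, inner_add_left, inner_add_right, inner_sub_left, inner_sub_right,
    inner_smul_left, inner_smul_right, Complex.conj_I]
  ring

/-- Half the sum and half the difference of the two conditions separate `V` from `W`. -/
lemma boundaryConditions_iff {V W : E k →L[ℂ] E k} {y : ℝ → ℂ} :
    BoundaryConditions k l V W y ↔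
      Yp k l y l = V (Yp k l y 0) ∧ Ym k l y l = W (Ym k l y 0) := by
  have key : ∀ a b A B : E k,
      ((2 : ℂ) • A = (V + W) a + Complex.I • (V - W) b ∧
        (2 * Complex.I) • B = (V - W) a + Complex.I • (V + W) b) ↔
      (A + Complex.I • B = V (a + Complex.I • b) ∧ A - Complex.I • B = W (a - Complex.I • b)) := by
    intro a b A B
    simp only [add_apply, sub_apply, map_add, map_sub,
      map_smul]
    constructor
    · rintro ⟨h1, h2⟩
      constructor
      · linear_combination (norm := module) (1 / 2 : ℂ) • h1 + (1 / 2 : ℂ) • h2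
      · linear_combination (norm := module) (1 / 2 : ℂ) • h1 - (1 / 2 : ℂ) • h2
    · rintro ⟨h1, h2⟩
      constructor
      · linear_combination (norm := module) h1 + h2
      · linear_combination (norm := module) h1 - h2
  exact ⟨fun h => (key _ _ _ _).1 ⟨h.fst, h.snd⟩, fun h => ⟨((key _ _ _ _).2 h).1,
    ((key _ _ _ _).2 h).2⟩⟩

/-- The boundary data `Y±` can be prescribed at both end points. -/
lemma exists_isSobolev_Yp_Ym (hl : 0 < l) (u v u' v' : E k) :
    ∃ y : ℝ → ℂ, IsSobolev (2 * k) l y ∧ Yp k l y 0 = u ∧ Ym k l y 0 = v ∧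
      Yp k l y l = u' ∧ Ym k l y l = v' := by
  -- The derivatives for which `Y₀ = a` and `J Y₁ = b`, by inverting `JY₁_apply`; the final `0` is
  -- never reached for `n < 2k`.
  let α : E k → E k → ℕ → ℂ := fun a b n =>
    if h : n < k then a ⟨n, h⟩
    else if h : 2 * k - 1 - n < k then (-1) ^ (2 * k - 1 - n) * b ⟨2 * k - 1 - n, h⟩ else 0
  have hα : ∀ (a b : E k) (y : ℝ → ℂ) (x : ℝ), (∀ j < 2 * k, der l j y x = α a b j) →
      Y₀ k l y x = a ∧ JY₁ k l y x = b := by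
    intro a b y x h
    constructor
    · ext j
      have hj := j.2
      refine (h j (by omega)).trans ?_
      simp [α]
    · ext j
      have hj := j.2
      have e : 2 * k - 1 - (2 * k - 1 - (j : ℕ)) = j := by omega
      have hk : ¬ 2 * k - 1 - (j : ℕ) < k := by omega
      rw [JY₁_apply, h _ (by omega)]
      simp only [α, hk, e, hj, dif_pos, dif_neg, not_false_eq_true]
      rw [← mul_assoc, ← mul_pow]
      simp
  -- Solving `a + i b = s`, `a - i b = t` gives `a = (s + t)/2` and `b = -i (s - t)/2`.
  have hpm : ∀ s t : E k, (1 / 2 : ℂ) • (s + t) + Complex.I • (-Complex.I / 2) • (s - t) = s ∧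
      (1 / 2 : ℂ) • (s + t) - Complex.I • (-Complex.I / 2) • (s - t) = t := by
    intro s t
    have : Complex.I * (-Complex.I / 2) = 1 / 2 := by
      linear_combination (-1 / 2 : ℂ) * Complex.I_mul_I
    rw [smul_smul, this]
    constructor <;> module
  obtain ⟨y, hy, h⟩ := exists_isSobolev_der_eq hl (2 * k)
    (α ((1 / 2 : ℂ) • (u + v)) ((-Complex.I / 2) • (u - v)))
    (α ((1 / 2 : ℂ) • (u' + v')) ((-Complex.I / 2) • (u' - v')))
  obtain ⟨h1, h2⟩ := hα _ _ y 0 fun j hj => (h j hj).1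
  obtain ⟨h3, h4⟩ := hα _ _ y l fun j hj => (h j hj).2
  refine ⟨y, hy, ?_⟩
  simp only [Yp, Ym, h1, h2, h3, h4, (hpm u v).1, (hpm u v).2, (hpm u' v').1, (hpm u' v').2,
    and_self]

/-! ### Unitary boundary conditions -/

lemma inner_map_map_of_unitary {V : E k →L[ℂ] E k} (hV : V ∈ unitary (E k →L[ℂ] E k)) (x y : E k) :
    inner ℂ (V x) (V y) = inner ℂ x y := by
  have h := (Unitary.mem_iff.1 hV).1
  rw [ContinuousLinearMap.star_eq_adjoint] at h
  rw [← ContinuousLinearMap.adjoint_inner_left, ← mul_apply_eq_comp, h,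
    one_apply_eq_self]

/-- The hypothesis says `V* y = x`, and `V V* = 1` recovers `y`. -/
lemma eq_map_of_inner_unitary {V : E k →L[ℂ] E k} (hV : V ∈ unitary (E k →L[ℂ] E k)) {x y : E k}
    (h : ∀ u, inner ℂ y (V u) = inner ℂ x u) : y = V x := by
  have h2 := (Unitary.mem_iff.1 hV).2
  rw [ContinuousLinearMap.star_eq_adjoint] at h2
  have : ContinuousLinearMap.adjoint V y = x :=
    ext_inner_right ℂ fun u => by rw [ContinuousLinearMap.adjoint_inner_left, h]
  rw [← this, ← mul_apply_eq_comp, h2, one_apply_eq_self]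

lemma BoundaryConditions.bdryForm_eq {V W : E k →L[ℂ] E k} (hV : V ∈ unitary (E k →L[ℂ] E k))
    (hW : W ∈ unitary (E k →L[ℂ] E k)) {y z : ℝ → ℂ} (hy : BoundaryConditions k l V W y)
    (hz : BoundaryConditions k l V W z) :
    bdryForm (2 * k) l y z l = bdryForm (2 * k) l y z 0 := by
  rw [boundaryConditions_iff] at hy hz
  refine mul_left_cancel₀ (mul_ne_zero two_ne_zero Complex.I_ne_zero) ?_
  rw [two_I_mul_bdryForm, two_I_mul_bdryForm, hy.1, hy.2, hz.1, hz.2,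
    inner_map_map_of_unitary hV, inner_map_map_of_unitary hW]

/-- Choose `y` in the domain with `Y₊(0) = u`, `Y₋(0) = v` arbitrary; setting `v = 0` or `u = 0`
isolates each condition on `z`. -/
lemma boundaryConditions_of_bdryForm_eq (hl : 0 < l) {V W : E k →L[ℂ] E k}
    (hV : V ∈ unitary (E k →L[ℂ] E k)) (hW : W ∈ unitary (E k →L[ℂ] E k)) {z : ℝ → ℂ}
    (h : ∀ y, IsSobolev (2 * k) l y → BoundaryConditions k l V W y →
      bdryForm (2 * k) l y z l = bdryForm (2 * k) l y z 0) :
    BoundaryConditions k l V W z := by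
  have key : ∀ u v : E k, inner ℂ (Yp k l z l) (V u) - inner ℂ (Ym k l z l) (W v)
      = inner ℂ (Yp k l z 0) u - inner ℂ (Ym k l z 0) v := by
    intro u v
    obtain ⟨y, hy, h1, h2, h3, h4⟩ := exists_isSobolev_Yp_Ym hl u v (V u) (W v)
    have e := congrArg (2 * Complex.I * ·) (h y hy (boundaryConditions_iff.2
      ⟨by rw [h1, h3], by rw [h2, h4]⟩))
    simpa only [two_I_mul_bdryForm, h1, h2, h3, h4] using e
  refine boundaryConditions_iff.2 ⟨eq_map_of_inner_unitary hV fun u => ?_,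
    eq_map_of_inner_unitary hW fun v => ?_⟩
  · simpa using key u 0
  · simpa using key 0 v

/-! ### Self-adjointness -/

variable {hk : 0 < k} {hl : 0 < l} {V W : E k →L[ℂ] E k}

lemma IsSobolevZero.boundaryConditions {y : ℝ → ℂ} (hy : IsSobolevZero (2 * k) l y) :
    BoundaryConditions k l V W y := by
  have h0 : ∀ x, (∀ j < 2 * k, der l j y x = 0) → Y₀ k l y x = 0 ∧ JY₁ k l y x = 0 := by
    intro x h
    constructor
    · ext j
      exact h j (by omega)
    · ext j
      rw [JY₁_apply, h _ (by omega)]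
      simp
  obtain ⟨h1, h2⟩ := h0 0 hy.left
  obtain ⟨h3, h4⟩ := h0 l hy.right
  constructor <;> simp [h1, h2, h3, h4]

/-- If `g` is orthogonal to the domain, it is a weak `2k`-th derivative of the zero function, hence
zero. -/
lemma dense_dom : Dense (dom k hk l hl V W : Set (H l)) := by
  rw [Submodule.dense_iff_topologicalClosure_eq_top, Submodule.topologicalClosure_eq_top_iff,
    Submodule.eq_bot_iff]
  intro g hg
  have hp : 0 < 2 * k := by omega
  obtain ⟨z, hz, hwz, hzg⟩ := exists_isSobolev_of_weak (w := 0) (g := g) hp hl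
    fun y f f' hy hf _ => by
      rw [(Submodule.mem_orthogonal' _ _).1 hg f ⟨y, hy.toIsSobolev, hy.boundaryConditions, hf⟩]
      simp
  have h0 : der l (2 * k) z =ᵐ[μ l] der l (2 * k) 0 :=
    hz.der_congr hl .zero (hwz.symm.trans (Lp.coeFn_zero ℂ 2 (μ l)))
  refine Lp.ext (hzg.symm.trans (h0.trans ?_))
  filter_upwards [Lp.coeFn_zero ℂ 2 (μ l)] with x hx
  rw [hx]
  simp

lemma neg_I_pow_two_mul (k : ℕ) : (-Complex.I) ^ (2 * k) = (-1) ^ k := by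
  rw [pow_mul, neg_sq, Complex.I_sq]

lemma op_isFormalAdjoint (hV : V ∈ unitary (E k →L[ℂ] E k)) (hW : W ∈ unitary (E k →L[ℂ] E k)) :
    (op k hk l hl V W).IsFormalAdjoint (op k hk l hl V W) := by
  intro g f
  obtain ⟨y, hy, bcy, hf⟩ := f.2
  obtain ⟨z, hz, bcz, hg⟩ := g.2
  rw [op_apply f hy hf, op_apply g hz hg, inner_smul_left, inner_smul_right, neg_I_pow_two_mul]
  have h := green_inner hl hy hz hf hg hy.memLp.coeFn_toLp hz.memLp.coeFn_toLp
  rw [bcy.bdryForm_eq hV hW bcz, sub_self, sub_eq_zero, pow_mul] at h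
  rw [h]
  simp

lemma adjoint_domain_le (hV : V ∈ unitary (E k →L[ℂ] E k)) (hW : W ∈ unitary (E k →L[ℂ] E k)) :
    (op k hk l hl V W).adjoint.domain ≤ (op k hk l hl V W).domain := by
  intro w hw
  have hp : 0 < 2 * k := by omega
  have hA := LinearPMap.adjoint_isFormalAdjoint (T := op k hk l hl V W) (dense_dom (hk := hk) (hl := hl))
  -- Since `(-i)^(2k) = (-1)^k` is real and its own inverse, `(-1)^k` times the adjoint's value at
  -- `w` is the candidate for the weak derivative.
  have hadj : ∀ (y : ℝ → ℂ) (f f' : H l), IsSobolev (2 * k) l y → BoundaryConditions k l V W y →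
      f =ᵐ[μ l] y → f' =ᵐ[μ l] der l (2 * k) y →
      inner ℂ w f' = (-1) ^ (2 * k) *
        inner ℂ ((-1 : ℂ) ^ k • (op k hk l hl V W).adjoint ⟨w, hw⟩) f := by
    intro y f f' hy bcy hf hf'
    have h := hA ⟨w, hw⟩ ⟨f, y, hy, bcy, hf⟩
    have e : hy.memLp.toLp = f' := Lp.ext (hy.memLp.coeFn_toLp.trans hf'.symm)
    rw [op_apply (hk := hk) (hl := hl) ⟨f, y, hy, bcy, hf⟩ hy hf, inner_smul_right, neg_I_pow_two_mul,
      e] at h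
    rw [inner_smul_left, h, pow_mul, ← mul_assoc, ← mul_assoc]
    simp [← mul_pow]
  obtain ⟨z, hz, hwz, hzg⟩ := exists_isSobolev_of_weak hp hl fun y f f' hy hf hf' =>
    hadj y f f' hy.toIsSobolev hy.boundaryConditions hf hf'
  refine ⟨z, hz, boundaryConditions_of_bdryForm_eq hl hV hW fun y hy bcy => ?_, hwz⟩
  have hf := (hy.memLp_self hl).coeFn_toLp
  have hf' := hy.memLp.coeFn_toLp
  have h := green_inner hl hy hz hf hwz hf' hzg.symm
  rw [hadj y _ _ hy bcy hf hf', sub_self] at h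
  exact sub_eq_zero.1 h.symm

end UnseparatedBVP
end

theorem proposition7p2 (k : ℕ) (hk : 0 < k) (l : ℝ) (hl : 0 < l)
    (V W : UnseparatedBVP.E k →L[ℂ] UnseparatedBVP.E k)
    (hV : V ∈ unitary (UnseparatedBVP.E k →L[ℂ] UnseparatedBVP.E k))
    (hW : W ∈ unitary (UnseparatedBVP.E k →L[ℂ] UnseparatedBVP.E k)) :
    Dense ((UnseparatedBVP.op k hk l hl V W).domain : Set (UnseparatedBVP.H l)) ∧
      IsSelfAdjoint (UnseparatedBVP.op k hk l hl V W) := by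
  have hd : Dense ((UnseparatedBVP.op k hk l hl V W).domain : Set (UnseparatedBVP.H l)) :=
    UnseparatedBVP.dense_dom (hk := hk) (hl := hl)
  -- A densely defined symmetric operator is contained in its adjoint, so only equality of domains
  -- remains.
  have hle := (UnseparatedBVP.op_isFormalAdjoint (hk := hk) (hl := hl) hV hW).le_adjoint hd
  exact ⟨hd, LinearPMap.isSelfAdjoint_def.2 (LinearPMap.eq_of_le_of_domain_eq hle
    (le_antisymm hle.1 (UnseparatedBVP.adjoint_domain_le hV hW))).symm⟩
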